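/- **Theorem 1.2.** Let $f,g\in\mathbb{Z}[X,Y]$ be binary quadratic forms with non-zero discriminant. Write every rational point of $\mathbb{P}^1(\mathbb{Q})\times\mathbb{P}^1(\mathbb{Q})$ as $(u,v)=([u_1:u_2],[v_1:v_2])$ with $\gcd(u_1,u_2)=\gcd(v_1,v_2)=1$, and put $H(u,v)=\max\{|u_1|,|u_2|\}^2\max\{|v_1|,|v_2|\}^2$. For real $B$ let $N_1(B)$ be the number of $(u,v)$ with $H(u,v)\le B$ such that $f(u_1,u_2)$ or $g(v_1,v_2)$ is the square of an integer, and let $N_2(B)$ be the number of $(u,v)$ with $H(u,v)\le B$ such that $f(u_1,u_2)g(v_1,v_2)$ is the square of a non-zero integer. A form is said to represent a square if it takes a square value at some pair of integers that are not both zero. Then: 1. If neither $f$ nor $g$ represents a square, then $N_1(B)=0$ for all $B$. 2. If at least one of $f$ and $g$ represents a square, then there are constants $c,C>0$ and $B_0$ depending only on $f$ and $g$ such that $N_1(B)\le CB$ for all $B\ge 2$ and $N_1(B)\ge cB$ for all $B\ge B_0$. 3. There is a constant $C$ depending only on $f$ and $g$ such that $N_2(B)\le C\,B^{2/3}(\log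 B)^9$ for all $B\ge 2$. Parts 1 and 2 hold under each of the two conventions for the word "square", namely that $0$ counts as a square or that it does not, where the same convention is used in the definition of $N_1$ and in "represents a square". -/

import Mathlib

open scoped LinearAlgebra.Projectivization

/-- An integral binary quadratic form `a X² + b X Y + c Y²`. -/
@[ext]
structure BinaryForm where
  a : ℤ
  b : ℤ
  c : ℤ

namespace BinaryForm

/-- The value of the form at a pair of integers. -/
def eval (f : BinaryForm) (u : ℤ × ℤ) : ℤ :=
  f.a * u.1 ^ 2 + f.b * u.1 * u.2 + f.c * u.2 ^ 2

/-- The discriminant `b² - 4ac`. -/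
def discr (f : BinaryForm) : ℤ := f.b ^ 2 - 4 * f.a * f.c

/-- The form takes a value in `S` at some pair of integers that are not both zero. -/
def Represents (f : BinaryForm) (S : ℤ → Prop) : Prop :=
  ∃ u : ℤ × ℤ, u ≠ 0 ∧ S (f.eval u)

end BinaryForm

/-- The integer `n` is the square of a nonzero integer. -/
def IsNonzeroSquare (n : ℤ) : Prop := n ≠ 0 ∧ IsSquare n

/-- The set of rational points of the projective line. -/
abbrev P1Q : Type := ℙ ℚ (Fin 2 → ℚ)

/-- The pair of integers `u` is coprime, and `p = [u.1 : u.2]`. -/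
def IsPrimitiveRep (u : ℤ × ℤ) (p : P1Q) : Prop :=
  IsCoprime u.1 u.2 ∧
    ∃ h : (![(u.1 : ℚ), (u.2 : ℚ)] : Fin 2 → ℚ) ≠ 0, Projectivization.mk ℚ _ h = p

theorem exists_isPrimitiveRep (p : P1Q) : ∃ u : ℤ × ℤ, IsPrimitiveRep u p := by
  induction p using Projectivization.ind with
  | h v hv =>
    by_cases h1 : v 1 = 0
    · have h0 : v 0 ≠ 0 := by
        intro h0
        apply hv
        ext i
        fin_cases i <;> simp [h0, h1]
      refine ⟨(1, 0), isCoprime_one_left, ?_, ?_⟩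
      · intro h
        simpa using congrFun h 0
      · rw [Projectivization.mk_eq_mk_iff']
        refine ⟨(v 0)⁻¹, ?_⟩
        ext i
        fin_cases i <;> simp [h0, h1]
    · refine ⟨((v 0 / v 1).num, ((v 0 / v 1).den : ℤ)), ?_, ?_, ?_⟩
      · exact Rat.isCoprime_num_den _
      · intro h
        have := congrFun h 1
        simp at this
      · rw [Projectivization.mk_eq_mk_iff']
        refine ⟨((v 0 / v 1).den : ℚ) / v 1, ?_⟩
        ext i
        fin_cases i
        · have h := Rat.den_mul_eq_num (v 0 / v 1)
          simp only [Fin.zero_eta, Pi.smul_apply, smul_eq_mul, Matrix.cons_val_zero]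
          rw [← h]
          ring
        · simp [h1]

/-- Coprime integers `(u₁, u₂)` with `p = [u₁ : u₂]`. They are unique up to a common sign, and that
sign affects neither the height nor the values of binary quadratic forms. -/
noncomputable def primCoords (p : P1Q) : ℤ × ℤ := (exists_isPrimitiveRep p).choose

theorem primCoords_spec (p : P1Q) : IsPrimitiveRep (primCoords p) p :=
  (exists_isPrimitiveRep p).choose_spec

/-- The height `max(|u₁|, |u₂|)² · max(|v₁|, |v₂|)²` of a rational point of `ℙ¹ × ℙ¹`. -/
noncomputable def anticanonicalHeight (x : P1Q × P1Q) : ℤ :=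
  max |(primCoords x.1).1| |(primCoords x.1).2| ^ 2 *
    max |(primCoords x.2).1| |(primCoords x.2).2| ^ 2

/-- The points `(u, v)` such that `f(u)` or `g(v)` is in `S`. -/
def thinOne (S : ℤ → Prop) (f g : BinaryForm) : Set (P1Q × P1Q) :=
  {x | S (f.eval (primCoords x.1)) ∨ S (g.eval (primCoords x.2))}

/-- The points `(u, v)` such that `f(u) g(v)` is in `S`. -/
def thinTwo (S : ℤ → Prop) (f g : BinaryForm) : Set (P1Q × P1Q) :=
  {x | S (f.eval (primCoords x.1) * g.eval (primCoords x.2))}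

/-- The number of points of height at most `B` in a set of rational points of `ℙ¹ × ℙ¹`. -/
noncomputable def countPoints (T : Set (P1Q × P1Q)) (B : ℝ) : ℕ :=
  {x ∈ T | (anticanonicalHeight x : ℝ) ≤ B}.ncard

theorem primCoords_injective : Function.Injective primCoords := by
  intro p q h
  obtain ⟨-, h1, h2⟩ := primCoords_spec p
  obtain ⟨-, h3, h4⟩ := primCoords_spec q
  rw [← h2, ← h4]
  simp only [h]

theorem one_le_max_primCoords (p : P1Q) : 1 ≤ max |(primCoords p).1| |(primCoords p).2| := by
  by_contra hlt
  have hm : max |(primCoords p).1| |(primCoords p).2| ≤ 0 := by omega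
  obtain ⟨-, h, -⟩ := primCoords_spec p
  have h1 : (primCoords p).1 = 0 := abs_nonpos_iff.mp ((le_max_left _ _).trans hm)
  have h2 : (primCoords p).2 = 0 := abs_nonpos_iff.mp ((le_max_right _ _).trans hm)
  apply h
  ext i
  fin_cases i <;> simp [h1, h2]

/-- The sets that are counted are finite, so that `Set.ncard` is their true cardinality. -/
theorem finite_height_le (T : Set (P1Q × P1Q)) (B : ℝ) :
    {x ∈ T | (anticanonicalHeight x : ℝ) ≤ B}.Finite := by
  have hfin : (Set.Icc ((-⌊B⌋, -⌊B⌋), (-⌊B⌋, -⌊B⌋)) ((⌊B⌋, ⌊B⌋), (⌊B⌋, ⌊B⌋)) :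
      Set ((ℤ × ℤ) × (ℤ × ℤ))).Finite := Set.finite_Icc _ _
  refine Set.Finite.of_finite_image (f := Prod.map primCoords primCoords) (hfin.subset ?_)
    ((primCoords_injective.prodMap primCoords_injective).injOn)
  rintro _ ⟨x, ⟨-, hx⟩, rfl⟩
  have hB : anticanonicalHeight x ≤ ⌊B⌋ := Int.le_floor.mpr hx
  unfold anticanonicalHeight at hB
  have hm := one_le_max_primCoords x.1
  have hn := one_le_max_primCoords x.2
  set m := max |(primCoords x.1).1| |(primCoords x.1).2| with hmd
  set n := max |(primCoords x.2).1| |(primCoords x.2).2| with hnd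
  have hm2 : m ≤ m ^ 2 := by nlinarith
  have hn2 : n ≤ n ^ 2 := by nlinarith
  have hmB : m ≤ ⌊B⌋ := by nlinarith [mul_nonneg (sq_nonneg m) (sub_nonneg.mpr (hn.trans hn2))]
  have hnB : n ≤ ⌊B⌋ := by nlinarith [mul_nonneg (sq_nonneg n) (sub_nonneg.mpr (hm.trans hm2))]
  have a1 := abs_le.mp ((le_max_left _ _).trans (hmd ▸ hmB))
  have a2 := abs_le.mp ((le_max_right _ _).trans (hmd ▸ hmB))
  have a3 := abs_le.mp ((le_max_left _ _).trans (hnd ▸ hnB))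
  have a4 := abs_le.mp ((le_max_right _ _).trans (hnd ▸ hnB))
  exact ⟨⟨⟨a1.1, a2.1⟩, ⟨a3.1, a4.1⟩⟩, ⟨⟨a1.2, a2.2⟩, ⟨a3.2, a4.2⟩⟩⟩

/-!
# Rational points on thin subsets of a product of two projective lines

The heart of the matter is a bound for the number of rational points `u` of height at most `X` on
the projective line such that `f(u) = n w²`, with `n` squarefree and `w ≠ 0`. It has to be uniform
in `n`, and decay like `|n|^(-1/2)` (`exists_ncard_conicPoints_le`). Points on the conic
`f(u) = n w²` repel each other: if `P` is the polar form of `f`, then two points `(u, w)` and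
`(v, w')` satisfy
`(P(u,v) - 2 n w w') (P(u,v) + 2 n w w') = disc(f) (u₁ v₂ - u₂ v₁)²`,
so that distinct points have non-zero polar form `P(u,v) - 2 n w w'` for either sign of `w'`. If
`u` and `v` agree modulo a prime `p` not dividing `n`, then for one of the signs this integer is
divisible by `p²`. If they also agree modulo `n`, it is divisible by `n`, up to a factor dividing
`disc(f)`. As it is `≪ X²`, there are no two such points once `p² |n|` exceeds a constant times `X²`
(`BinaryForm.wedge_eq_zero_of_dvd`). There are `p + 1` classes modulo `p`, and at most `d(|n|)`
classes modulo `n` to consider: they are told apart by greatest common divisors with `n`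
(`BinaryForm.dvd_discr_mul_wedge_of_gcd_eq`). Hence there are `≪ p d(|n|)` points, and `p` can be
taken not much larger than `X / √|n|`. Generous losses in the divisor bound and in the choice of `p`
lead to `≪ X^(4/3) / √|n|`.

If `f(u) g(v)` is a non-zero square, then `f(u)` and `g(v)` have the same squarefree part `n`. When
the heights of `u` and `v` are at most `U` and `V`, the bound gives `≪ (U V)^(4/3) ∑ 1 / |n|` pairs.
A dyadic decomposition of the region `H(u) H(v) ≤ √B` costs one more logarithm, which gives
`≪ B^(2/3) (log B)²` for the second thin set.

For the first thin set, the case `n = 1` shows that at most `≪ X^(4/3)` points `u` of height at most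
`X` have a square value `f(u)`. Thus the sum of `H(u)⁻²` over these `u` converges, and the fibres
over them have `≪ B` points in all. Conversely, one fibre has `≫ B` points, because a positive
proportion of the integer vectors is primitive (`le_ncard_ht_le`).
-/

/-! ### The polar form and the repulsion of points -/

/-- The determinant of two integer vectors; for coprime vectors it vanishes exactly when they
represent the same point of the projective line. -/
def wedge (u v : ℤ × ℤ) : ℤ := u.1 * v.2 - u.2 * v.1

namespace BinaryForm

/-- The polar bilinear form, normalised so that `polar f u u = 2 f(u)`. -/
def polar (f : BinaryForm) (u v : ℤ × ℤ) : ℤ :=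
  2 * f.a * u.1 * v.1 + f.b * (u.1 * v.2 + u.2 * v.1) + 2 * f.c * u.2 * v.2

/-- The sum of the absolute values of the coefficients. -/
def size (f : BinaryForm) : ℤ := |f.a| + |f.b| + |f.c|

theorem polar_sq (f : BinaryForm) (u v : ℤ × ℤ) :
    f.polar u v ^ 2 = f.discr * wedge u v ^ 2 + 4 * f.eval u * f.eval v := by
  simp only [polar, discr, wedge, eval]; ring

theorem size_nonneg (f : BinaryForm) : 0 ≤ f.size := by
  unfold size; positivity

theorem one_le_size {f : BinaryForm} (hf : f.discr ≠ 0) : 1 ≤ f.size := by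
  by_contra h
  have h0 : f.size = 0 := by have := f.size_nonneg; omega
  unfold size at h0
  have h1 := abs_nonneg f.a
  have h2 := abs_nonneg f.b
  have h3 := abs_nonneg f.c
  have ha : f.a = 0 := abs_eq_zero.mp (by omega)
  have hb : f.b = 0 := abs_eq_zero.mp (by omega)
  exact hf (by simp [discr, ha, hb])

theorem abs_eval_le (f : BinaryForm) {u : ℤ × ℤ} {X : ℤ} (h1 : |u.1| ≤ X) (h2 : |u.2| ≤ X) :
    |f.eval u| ≤ f.size * X ^ 2 := by
  have hX : 0 ≤ X := (abs_nonneg _).trans h1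
  have e1 : |f.a * u.1 ^ 2| ≤ |f.a| * X ^ 2 := by
    rw [abs_mul, abs_pow]; gcongr
  have e2 : |f.b * u.1 * u.2| ≤ |f.b| * X ^ 2 := by
    rw [abs_mul, abs_mul, mul_assoc, sq]; gcongr
  have e3 : |f.c * u.2 ^ 2| ≤ |f.c| * X ^ 2 := by
    rw [abs_mul, abs_pow]; gcongr
  calc |f.eval u| ≤ |f.a * u.1 ^ 2| + |f.b * u.1 * u.2| + |f.c * u.2 ^ 2| := abs_add_three _ _ _
    _ ≤ f.size * X ^ 2 := by unfold size; linarith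

theorem abs_polar_le (f : BinaryForm) {u v : ℤ × ℤ} {X : ℤ} (h1 : |u.1| ≤ X) (h2 : |u.2| ≤ X)
    (h3 : |v.1| ≤ X) (h4 : |v.2| ≤ X) : |f.polar u v| ≤ 2 * f.size * X ^ 2 := by
  have hX : 0 ≤ X := (abs_nonneg _).trans h1
  have key : ∀ x y : ℤ, |x| ≤ X → |y| ≤ X → |x * y| ≤ X ^ 2 := by
    intro x y hx hy
    rw [abs_mul, sq]; gcongr
  have e1 : |2 * f.a * u.1 * v.1| ≤ 2 * |f.a| * X ^ 2 := by
    rw [mul_assoc, abs_mul, abs_mul]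
    exact mul_le_mul_of_nonneg_left (key _ _ h1 h3) (by positivity)
  have e2 : |f.b * (u.1 * v.2 + u.2 * v.1)| ≤ |f.b| * (X ^ 2 + X ^ 2) := by
    rw [abs_mul]
    exact mul_le_mul_of_nonneg_left
      ((abs_add_le _ _).trans (add_le_add (key _ _ h1 h4) (key _ _ h2 h3))) (abs_nonneg _)
  have e3 : |2 * f.c * u.2 * v.2| ≤ 2 * |f.c| * X ^ 2 := by
    rw [mul_assoc, abs_mul, abs_mul]
    exact mul_le_mul_of_nonneg_left (key _ _ h2 h4) (by positivity)
  calc |f.polar u v| ≤ _ := abs_add_three _ _ _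
    _ ≤ 2 * f.size * X ^ 2 := by unfold size; linarith

/-- Two points of the conic `f = n w²` that agree modulo a prime `p` agree to second order: the
polar form of the conic at the two points is divisible by `p²`, for a suitable sign of `w'`. -/
theorem exists_sq_dvd_polar_sub (f : BinaryForm) {n w w' : ℤ} {u v : ℤ × ℤ}
    (hu : IsCoprime u.1 u.2) (hv : IsCoprime v.1 v.2)
    (hfu : f.eval u = n * w ^ 2) (hfv : f.eval v = n * w' ^ 2) {p : ℤ} (hp : Prime p)
    (hpn : ¬ p ∣ n) (hW : p ∣ wedge u v) :
    ∃ s : ℤ, s ^ 2 = w' ^ 2 ∧ p ^ 2 ∣ f.polar u v - 2 * n * w * s := by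
  obtain ⟨α, β, hαβ⟩ := hu
  -- `v = l • u + wedge u v • z`, so that `v` is a multiple of `u` modulo `p`
  set l := α * v.1 + β * v.2 with hl
  set z : ℤ × ℤ := (-β, α) with hz
  have hv1 : v.1 = l * u.1 - β * wedge u v := by
    simp only [hl, wedge]; linear_combination -v.1 * hαβ
  have hv2 : v.2 = l * u.2 + α * wedge u v := by
    simp only [hl, wedge]; linear_combination -v.2 * hαβ
  have hexp : f.eval v = l ^ 2 * f.eval u + wedge u v * (l * f.polar u z + wedge u v * f.eval z) := by
    generalize wedge u v = W at *
    simp only [eval, polar, hz, hv1, hv2]; ring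
  have hpol : f.polar u v = 2 * l * f.eval u + wedge u v * f.polar u z := by
    generalize wedge u v = W at *
    simp only [eval, polar, hz, hv1, hv2]; ring
  have hpl : ¬ p ∣ l := by
    intro h
    have d1 : p ∣ v.1 := by
      rw [hv1]; exact dvd_sub (h.mul_right _) (hW.mul_left _)
    have d2 : p ∣ v.2 := by
      rw [hv2]; exact dvd_add (h.mul_right _) (hW.mul_left _)
    exact hp.not_isUnit (hv.isUnit_of_dvd' d1 d2)
  have hdvd : p ∣ n * ((w' - l * w) * (w' + l * w)) := by
    have : n * ((w' - l * w) * (w' + l * w)) =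
        wedge u v * (l * f.polar u z + wedge u v * f.eval z) := by
      rw [hfu, hfv] at hexp; linear_combination hexp
    rw [this]; exact hW.mul_right _
  have fin : ∀ s : ℤ, s ^ 2 = w' ^ 2 → p ∣ s - l * w → p ^ 2 ∣ f.polar u v - 2 * n * w * s := by
    intro s hs hd
    have e : l * (f.polar u v - 2 * n * w * s) =
        n * (s - l * w) ^ 2 - wedge u v ^ 2 * f.eval z := by
      rw [hfu, hfv] at hexp
      rw [hpol, hfu]
      linear_combination -n * hs - hexp
    have : p ^ 2 ∣ l * (f.polar u v - 2 * n * w * s) := by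
      rw [e]
      exact dvd_sub ((pow_dvd_pow_of_dvd hd 2).mul_left _) ((pow_dvd_pow_of_dvd hW 2).mul_right _)
    exact hp.pow_dvd_of_dvd_mul_left 2 hpl this
  rcases hp.dvd_or_dvd ((hp.dvd_or_dvd hdvd).resolve_left hpn) with h | h
  · exact ⟨w', rfl, fin _ rfl h⟩
  · refine ⟨-w', by ring, fin _ (by ring) ?_⟩
    have : -w' - l * w = -(w' + l * w) := by ring
    rw [this]; exact (dvd_neg).mpr h

/-- Repulsion of the points of the conic `f = n w²`: distinct points of height at most `X` that lie
in the same class modulo `p` and in the same class modulo `n` force `p² |n| ≪ X²`. -/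
theorem wedge_eq_zero_of_dvd (f : BinaryForm) (hf : f.discr ≠ 0) {n w w' X : ℤ} {u v : ℤ × ℤ}
    (hu : IsCoprime u.1 u.2) (hv : IsCoprime v.1 v.2)
    (hfu : f.eval u = n * w ^ 2) (hfv : f.eval v = n * w' ^ 2)
    (hu1 : |u.1| ≤ X) (hu2 : |u.2| ≤ X) (hv1 : |v.1| ≤ X) (hv2 : |v.2| ≤ X)
    {p : ℤ} (hp : Prime p) (hpn : ¬ p ∣ n) (hW : p ∣ wedge u v)
    (hn : n ∣ f.discr * wedge u v)
    (hlarge : |f.discr| * (4 * f.size * X ^ 2) < p ^ 2 * |n|) : wedge u v = 0 := by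
  obtain ⟨s, hs, hB⟩ := f.exists_sq_dvd_polar_sub hu hv hfu hfv hp hpn hW
  rw [← hs] at hfv
  set B := f.polar u v - 2 * n * w * s with hBdef
  have hsq := f.polar_sq u v
  rw [hfu, hfv] at hsq
  have hnP : n ∣ f.discr * f.polar u v := by
    rw [← Int.pow_dvd_pow_iff (two_ne_zero)]
    have : (f.discr * f.polar u v) ^ 2 =
        f.discr * (f.discr * wedge u v) ^ 2 + n ^ 2 * (4 * f.discr ^ 2 * w ^ 2 * s ^ 2) := by
      rw [mul_pow, hsq]; ring
    rw [this]
    exact dvd_add ((pow_dvd_pow_of_dvd hn 2).mul_left _) (dvd_mul_right _ _)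
  have hnB : n ∣ f.discr * B := by
    have : f.discr * B = f.discr * f.polar u v - n * (2 * w * s * f.discr) := by rw [hBdef]; ring
    rw [this]
    exact dvd_sub hnP (dvd_mul_right _ _)
  have hcop : IsCoprime (p ^ 2) n := ((hp.irreducible.coprime_iff_not_dvd).mpr hpn).pow_left
  have hdvd : p ^ 2 * n ∣ f.discr * B := hcop.mul_dvd (hB.mul_left _) hnB
  have hX : 0 ≤ X := (abs_nonneg _).trans hu1
  have hnws : |n * w * s| ≤ f.size * X ^ 2 := by
    have hA : 0 ≤ f.size * X ^ 2 := mul_nonneg f.size_nonneg (by positivity)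
    apply abs_le_of_sq_le_sq _ hA
    have e : (n * w * s) ^ 2 = f.eval u * f.eval v := by rw [hfu, hfv]; ring
    rw [e]
    calc f.eval u * f.eval v ≤ |f.eval u * f.eval v| := le_abs_self _
      _ = |f.eval u| * |f.eval v| := abs_mul _ _
      _ ≤ (f.size * X ^ 2) * (f.size * X ^ 2) :=
        mul_le_mul (f.abs_eval_le hu1 hu2) (f.abs_eval_le hv1 hv2) (abs_nonneg _) hA
      _ = _ := by ring
  have hBle : |B| ≤ 4 * f.size * X ^ 2 := by
    have h1 := f.abs_polar_le hu1 hu2 hv1 hv2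
    have h2 : |2 * n * w * s| = 2 * |n * w * s| := by
      rw [show 2 * n * w * s = 2 * (n * w * s) by ring, abs_mul]; rfl
    calc |B| ≤ |f.polar u v| + |2 * n * w * s| := abs_sub _ _
      _ ≤ _ := by rw [h2]; linarith
  have hB0 : B = 0 := by
    have : f.discr * B = 0 := by
      apply Int.eq_zero_of_abs_lt_dvd ((abs_dvd _ _).mpr hdvd)
      rw [abs_mul, abs_mul, abs_pow, sq_abs]
      exact lt_of_le_of_lt (mul_le_mul_of_nonneg_left hBle (abs_nonneg _)) hlarge
    exact (mul_eq_zero.mp this).resolve_left hf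
  have hP : f.polar u v = 2 * n * w * s := by linarith
  rw [hP] at hsq
  have : f.discr * wedge u v ^ 2 = 0 := by linear_combination -hsq
  simpa [hf] using this

/-- A quadratic form modulo `n` has few zeros: three of them are dependent up to the
discriminant. For `n = 0` this bounds the number of zeros on the projective line. -/
theorem dvd_discr_mul_wedge (f : BinaryForm) {n : ℤ} {u v z : ℤ × ℤ} (hu : n ∣ f.eval u)
    (hv : n ∣ f.eval v) (hz : n ∣ f.eval z) :
    n ∣ f.discr * (wedge u v ^ 2 * wedge u z * wedge v z) := by
  have h1 : wedge u z * wedge v z * f.polar u v =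
      wedge u z ^ 2 * f.eval v + wedge v z ^ 2 * f.eval u - wedge u v ^ 2 * f.eval z := by
    simp only [polar, wedge, eval]; ring
  have h2 : n ∣ wedge u z * wedge v z * f.polar u v := by
    rw [h1]
    exact dvd_sub (dvd_add (hv.mul_left _) (hu.mul_left _)) (hz.mul_left _)
  have h3 : f.discr * (wedge u v ^ 2 * wedge u z * wedge v z) =
      f.polar u v * (wedge u z * wedge v z * f.polar u v) -
        f.eval u * (4 * f.eval v * (wedge u z * wedge v z)) := by
    linear_combination -(wedge u z * wedge v z) * f.polar_sq u v
  rw [h3]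
  exact dvd_sub (h2.mul_left _) (hu.mul_right _)

/-- For squarefree `n` and a fixed zero `u` of `f` modulo `n`, the class modulo `n` of a further
zero `v` is determined by `gcd(n, wedge u v)`, up to the discriminant. -/
theorem dvd_discr_mul_wedge_of_gcd_eq (f : BinaryForm) {n : ℤ} (hn : Squarefree n)
    {u v z : ℤ × ℤ} (hcop : IsCoprime u.1 u.2) (hu : n ∣ f.eval u)
    (hv : n ∣ f.eval v) (hz : n ∣ f.eval z)
    (h : Int.gcd n (wedge u v) = Int.gcd n (wedge u z)) : n ∣ f.discr * wedge v z := by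
  obtain ⟨e, he⟩ : (Int.gcd n (wedge u v) : ℤ) ∣ n := Int.gcd_dvd_left _ _
  have d1 : (Int.gcd n (wedge u v) : ℤ) ∣ wedge u v := Int.gcd_dvd_right _ _
  have d2 : (Int.gcd n (wedge u v) : ℤ) ∣ wedge u z := h ▸ Int.gcd_dvd_right _ _
  have c1 : IsCoprime e (wedge u v) := by
    rw [← isRelPrime_iff_isCoprime]
    intro g hg1 hg2
    have hgn : g ∣ n := he ▸ hg1.mul_left _
    have hgd := Int.dvd_coe_gcd hgn hg2
    exact hn g (he ▸ mul_dvd_mul hgd hg1)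
  have c2 : IsCoprime e (wedge u z) := by
    rw [← isRelPrime_iff_isCoprime]
    intro g hg1 hg2
    have hgn : g ∣ n := he ▸ hg1.mul_left _
    have hgd : g ∣ (Int.gcd n (wedge u v) : ℤ) := h ▸ Int.dvd_coe_gcd hgn hg2
    exact hn g (he ▸ mul_dvd_mul hgd hg1)
  set d : ℤ := (Int.gcd n (wedge u v) : ℤ) with hd
  have cde : IsCoprime d e := by
    rw [← isRelPrime_iff_isCoprime]
    intro g hg1 hg2
    exact hn g (he ▸ mul_dvd_mul hg1 hg2)
  have hdW : d ∣ wedge v z := by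
    obtain ⟨α, β, hαβ⟩ := hcop
    have : wedge v z =
        wedge u z * (α * v.1 + β * v.2) - wedge u v * (α * z.1 + β * z.2) := by
      simp only [wedge]
      linear_combination -(v.1 * z.2 - v.2 * z.1) * hαβ
    rw [this]
    exact dvd_sub (d2.mul_right _) (d1.mul_right _)
  have heW : e ∣ f.discr * wedge v z := by
    have h1 := f.dvd_discr_mul_wedge hu hv hz
    have h2 : e ∣ (wedge u v ^ 2 * wedge u z) * (f.discr * wedge v z) := by
      have : (wedge u v ^ 2 * wedge u z) * (f.discr * wedge v z) =
        f.discr * (wedge u v ^ 2 * wedge u z * wedge v z) := by ring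
      rw [this]
      exact (Dvd.intro_left d he.symm).trans h1
    exact (c1.pow_right.mul_right c2).dvd_of_dvd_mul_left h2
  rw [he]
  exact cde.mul_dvd (hdW.mul_left _) heW

end BinaryForm

/-! ### Primes and divisors -/

/-- Bertrand's postulate with the divisors of `N` left out. -/
theorem exists_prime_not_dvd (J : ℕ) : ∀ P N : ℕ, 1 ≤ P → N ≠ 0 → N < P ^ J →
    ∃ p : ℕ, p.Prime ∧ P < p ∧ p ≤ 2 ^ J * P ∧ ¬ p ∣ N := by
  induction J with
  | zero => intro P N _ hN h; simp at h; omega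
  | succ J ih =>
    intro P N hP hN h
    obtain ⟨p, hp, h1, h2⟩ := Nat.exists_prime_lt_and_le_two_mul P (by omega)
    by_cases hd : p ∣ N
    · obtain ⟨M, rfl⟩ := hd
      have hM : M < (2 * P) ^ J := by
        have : P * M < P * P ^ J := by
          calc P * M ≤ p * M := by gcongr
            _ < P ^ (J + 1) := h
            _ = P * P ^ J := by ring
        exact (lt_of_mul_lt_mul_left this (by omega)).trans_le
          (Nat.pow_le_pow_left (by omega) _)
      obtain ⟨q, hq, h3, h4, h5⟩ := ih (2 * P) M (by omega) (by rintro rfl; simp at hN) hM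
      refine ⟨q, hq, by omega, h4.trans (le_of_eq (by ring)), ?_⟩
      intro hqd
      rcases (Nat.Prime.dvd_mul hq).mp hqd with h6 | h6
      · have := (Nat.prime_dvd_prime_iff_eq hq hp).mp h6
        omega
      · exact h5 h6
    · refine ⟨p, hp, h1, h2.trans ?_, hd⟩
      gcongr
      exact Nat.le_self_pow (by omega) 2

/-- The divisor bound for squarefree numbers: `d(n) ≪ n^(1/k)`. -/
theorem exists_card_divisors_pow_le (k : ℕ) :
    ∃ C : ℕ, ∀ n : ℕ, Squarefree n → n.divisors.card ^ k ≤ C * n := by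
  refine ⟨(2 ^ k) ^ (2 ^ k), fun n hn => ?_⟩
  have h0 := hn.ne_zero
  have hcard : n.divisors.card = ∏ p ∈ n.primeFactors, 2 := by
    rw [Nat.card_divisors h0]
    refine Finset.prod_congr rfl fun p hp => ?_
    have := hn.natFactorization_le_one p
    have h2 := (Nat.prime_of_mem_primeFactors hp).factorization_pos_of_dvd h0
      (Nat.dvd_of_mem_primeFactors hp)
    omega
  have hprod : ∏ p ∈ n.primeFactors, p = n := Nat.prod_primeFactors_of_squarefree hn
  calc n.divisors.card ^ k = ∏ p ∈ n.primeFactors, 2 ^ k := by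
        rw [hcard, Finset.prod_pow]
    _ ≤ ∏ p ∈ n.primeFactors, ((if p < 2 ^ k then 2 ^ k else 1) * p) := by
        refine Finset.prod_le_prod' fun p hp => ?_
        have := (Nat.prime_of_mem_primeFactors hp).pos
        split_ifs with h
        · exact Nat.le_mul_of_pos_right _ this
        · omega
    _ = (∏ p ∈ n.primeFactors, (if p < 2 ^ k then 2 ^ k else 1)) * n := by
        rw [Finset.prod_mul_distrib, hprod]
    _ ≤ (2 ^ k) ^ (2 ^ k) * n := by
        gcongr
        rw [Finset.prod_ite, Finset.prod_const, Finset.prod_const_one, mul_one]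
        apply Nat.pow_le_pow_right (by positivity)
        calc _ ≤ (Finset.range (2 ^ k)).card := Finset.card_le_card fun p hp => by
              simpa using (Finset.mem_filter.mp hp).2
          _ = _ := Finset.card_range _

/-! ### Points of bounded height on the projective line -/

/-- The height `max(|u₁|, |u₂|)` of a rational point of the projective line. -/
noncomputable def ht (p : P1Q) : ℕ := max (primCoords p).1.natAbs (primCoords p).2.natAbs

theorem natCast_ht (p : P1Q) : (ht p : ℤ) = max |(primCoords p).1| |(primCoords p).2| := by
  simp [ht]

theorem one_le_ht (p : P1Q) : 1 ≤ ht p := by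
  have := one_le_max_primCoords p
  rw [← natCast_ht] at this
  exact_mod_cast this

theorem abs_primCoords_le {p : P1Q} {X : ℕ} (h : ht p ≤ X) :
    |(primCoords p).1| ≤ X ∧ |(primCoords p).2| ≤ X := by
  have h' : (ht p : ℤ) ≤ X := by exact_mod_cast h
  rw [natCast_ht] at h'
  exact ⟨(le_max_left _ _).trans h', (le_max_right _ _).trans h'⟩

theorem isCoprime_primCoords (p : P1Q) : IsCoprime (primCoords p).1 (primCoords p).2 :=
  (primCoords_spec p).1

/-- An integer vector representing `p` is a multiple of the primitive coordinates of `p`. -/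
theorem exists_eq_mul_primCoords {u : ℤ × ℤ} {p : P1Q} (h : wedge (primCoords p) u = 0) :
    ∃ d : ℤ, u.1 = d * (primCoords p).1 ∧ u.2 = d * (primCoords p).2 := by
  obtain ⟨α, β, hαβ⟩ := isCoprime_primCoords p
  simp only [wedge] at h
  refine ⟨α * u.1 + β * u.2, ?_, ?_⟩
  · linear_combination -u.1 * hαβ - β * h
  · linear_combination -u.2 * hαβ + α * h

theorem eq_of_wedge_eq_zero {p q : P1Q} (h : wedge (primCoords p) (primCoords q) = 0) :
    p = q := by
  obtain ⟨d, h1, h2⟩ := exists_eq_mul_primCoords h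
  obtain ⟨-, hp, hp'⟩ := primCoords_spec p
  obtain ⟨-, hq, hq'⟩ := primCoords_spec q
  rw [← hp', ← hq', eq_comm, Projectivization.mk_eq_mk_iff']
  refine ⟨d, ?_⟩
  ext i
  fin_cases i <;> simp [h1, h2]

theorem wedge_primCoords_mk {u : ℤ × ℤ} (h : (![(u.1 : ℚ), (u.2 : ℚ)] : Fin 2 → ℚ) ≠ 0) :
    wedge (primCoords (Projectivization.mk ℚ _ h)) u = 0 := by
  obtain ⟨-, h1, h2⟩ := primCoords_spec (Projectivization.mk ℚ _ h)
  rw [Projectivization.mk_eq_mk_iff'] at h2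
  obtain ⟨a, ha⟩ := h2
  have e0 := congrFun ha 0
  have e1 := congrFun ha 1
  simp only [Pi.smul_apply, smul_eq_mul, Matrix.cons_val_zero, Matrix.cons_val_one] at e0 e1
  have : ((wedge (primCoords (Projectivization.mk ℚ _ h)) u : ℤ) : ℚ) = 0 := by
    unfold wedge
    push_cast
    rw [← e0, ← e1]
    ring
  exact_mod_cast this

theorem finite_ht_le (X : ℕ) : {p : P1Q | ht p ≤ X}.Finite := by
  refine Set.Finite.of_finite_image (f := primCoords)
    ((Set.finite_Icc ((-X : ℤ), (-X : ℤ)) ((X : ℤ), (X : ℤ))).subset ?_)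
    primCoords_injective.injOn
  rintro _ ⟨p, hp, rfl⟩
  obtain ⟨h1, h2⟩ := abs_primCoords_le hp
  exact ⟨⟨(abs_le.mp h1).1, (abs_le.mp h2).1⟩, ⟨(abs_le.mp h1).2, (abs_le.mp h2).2⟩⟩

theorem ncard_ht_le (X : ℕ) : {p : P1Q | ht p ≤ X}.ncard ≤ 9 * X ^ 2 := by
  rcases Nat.eq_zero_or_pos X with rfl | hX
  · have : {p : P1Q | ht p ≤ 0} = ∅ := by
      ext p
      have := one_le_ht p
      simp only [Set.mem_ofPred_eq, Set.mem_empty_iff_false, iff_false]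
      omega
    rw [this]; simp
  have h : {p : P1Q | ht p ≤ X}.ncard ≤
      ((Finset.Icc (-X : ℤ) X ×ˢ Finset.Icc (-X : ℤ) X : Finset (ℤ × ℤ)) : Set (ℤ × ℤ)).ncard := by
    refine Set.ncard_le_ncard_of_injOn primCoords ?_ primCoords_injective.injOn
      (Finset.finite_toSet _)
    intro p hp
    obtain ⟨h1, h2⟩ := abs_primCoords_le hp
    simp only [Finset.coe_product, Set.mem_prod, Finset.mem_coe, Finset.mem_Icc]
    exact ⟨abs_le.mp h1, abs_le.mp h2⟩
  rw [Set.ncard_coe_finset, Finset.card_product, Int.card_Icc] at h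
  have e : ((X : ℤ) + 1 - -X).toNat = 2 * X + 1 := by omega
  rw [e] at h
  nlinarith

/-- Every pair in `[1, Y]²` is coprime or a multiple of a pair in `[1, Y / d]²` with `d ≥ 2`. -/
theorem sq_le_card_coprime_add (Y : ℕ) :
    Y ^ 2 ≤ ((Finset.Icc 1 Y ×ˢ Finset.Icc 1 Y).filter fun u : ℕ × ℕ => u.1.Coprime u.2).card +
      ∑ d ∈ Finset.Icc 2 Y, (Y / d) ^ 2 := by
  have hsub : Finset.Icc 1 Y ×ˢ Finset.Icc 1 Y ⊆
      ((Finset.Icc 1 Y ×ˢ Finset.Icc 1 Y).filter fun u : ℕ × ℕ => u.1.Coprime u.2) ∪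
        (Finset.Icc 2 Y).biUnion fun d =>
          (Finset.Icc 1 (Y / d) ×ˢ Finset.Icc 1 (Y / d)).image fun u => (d * u.1, d * u.2) := by
    rintro ⟨x, y⟩ h
    rw [Finset.mem_union]
    by_cases hc : x.Coprime y
    · exact Or.inl (Finset.mem_filter.mpr ⟨h, hc⟩)
    right
    simp only [Finset.mem_product, Finset.mem_Icc] at h
    obtain ⟨⟨hx1, hx2⟩, hy1, hy2⟩ := h
    have hpos : 0 < x.gcd y := Nat.gcd_pos_of_pos_left _ hx1
    obtain ⟨x', hx'⟩ := Nat.gcd_dvd_left x y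
    obtain ⟨y', hy'⟩ := Nat.gcd_dvd_right x y
    have hle : x.gcd y ≤ Y := (Nat.gcd_le_left _ hx1).trans hx2
    have hne : x.gcd y ≠ 1 := hc
    rw [Finset.mem_biUnion]
    refine ⟨x.gcd y, Finset.mem_Icc.mpr ⟨by omega, hle⟩,
      Finset.mem_image.mpr ⟨(x', y'), ?_, Prod.ext hx'.symm hy'.symm⟩⟩
    have hx0 : x' ≠ 0 := by rintro rfl; omega
    have hy0 : y' ≠ 0 := by rintro rfl; omega
    simp only [Finset.mem_product, Finset.mem_Icc, Nat.le_div_iff_mul_le hpos]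
    refine ⟨⟨by omega, ?_⟩, by omega, ?_⟩
    · rw [mul_comm, ← hx']; exact hx2
    · rw [mul_comm, ← hy']; exact hy2
  calc Y ^ 2 = (Finset.Icc 1 Y ×ˢ Finset.Icc 1 Y).card := by
        rw [Finset.card_product, Nat.card_Icc, Nat.add_sub_cancel, sq]
    _ ≤ _ := (Finset.card_le_card hsub).trans (Finset.card_union_le _ _)
    _ ≤ _ := by
        gcongr
        refine Finset.card_biUnion_le.trans (Finset.sum_le_sum fun d _ => ?_)
        refine Finset.card_image_le.trans (le_of_eq ?_)
        rw [Finset.card_product, Nat.card_Icc, Nat.add_sub_cancel, sq]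

theorem four_mul_sum_sq_div_le (Y : ℕ) : 4 * ∑ d ∈ Finset.Icc 2 Y, (Y / d) ^ 2 ≤ 3 * Y ^ 2 := by
  have key : ∀ Z : ℕ, 2 ≤ Z → ∑ d ∈ Finset.Icc 2 Z, 1 / (d : ℝ) ^ 2 ≤ 3 / 4 - 1 / (Z : ℝ) := by
    intro Z hZ
    induction Z, hZ using Nat.le_induction with
    | base => norm_num
    | succ Z hZ ih =>
      rw [Finset.sum_Icc_succ_top (by omega)]
      have hZ0 : (0 : ℝ) < Z := by exact_mod_cast (by omega : 0 < Z)
      have : 1 / ((Z + 1 : ℕ) : ℝ) ^ 2 ≤ 1 / (Z : ℝ) - 1 / ((Z + 1 : ℕ) : ℝ) := by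
        push_cast
        rw [div_sub_div _ _ (by positivity) (by positivity),
          div_le_div_iff₀ (by positivity) (by positivity)]
        nlinarith
      linarith
  rcases lt_or_ge Y 2 with h | h
  · rw [Finset.Icc_eq_empty (by omega)]; simp
  have h1 : (∑ d ∈ Finset.Icc 2 Y, ((Y / d : ℕ) : ℝ) ^ 2) ≤ 3 / 4 * (Y : ℝ) ^ 2 := by
    calc _ ≤ ∑ d ∈ Finset.Icc 2 Y, (Y : ℝ) ^ 2 * (1 / (d : ℝ) ^ 2) := by
          refine Finset.sum_le_sum fun d _ => ?_
          rw [mul_one_div, ← div_pow]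
          exact pow_le_pow_left₀ (by positivity) Nat.cast_div_le 2
      _ = (Y : ℝ) ^ 2 * ∑ d ∈ Finset.Icc 2 Y, 1 / (d : ℝ) ^ 2 := by rw [Finset.mul_sum]
      _ ≤ (Y : ℝ) ^ 2 * (3 / 4) := by
          gcongr
          have : (0 : ℝ) ≤ 1 / (Y : ℝ) := by positivity
          linarith [key Y h]
      _ = _ := by ring
  have h2 : (4 : ℝ) * ∑ d ∈ Finset.Icc 2 Y, ((Y / d : ℕ) : ℝ) ^ 2 ≤ 3 * (Y : ℝ) ^ 2 := by linarith
  exact_mod_cast h2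

/-- Every coprime pair is, up to sign, the pair of primitive coordinates of some point. -/
theorem exists_primCoords_eq {u : ℤ × ℤ} (hu : IsCoprime u.1 u.2) :
    ∃ p : P1Q, primCoords p = u ∨ primCoords p = -u := by
  have h : (![(u.1 : ℚ), (u.2 : ℚ)] : Fin 2 → ℚ) ≠ 0 := by
    intro h
    have h1 : u.1 = 0 := by simpa using congrFun h 0
    have h2 : u.2 = 0 := by simpa using congrFun h 1
    rw [h1, h2] at hu
    exact not_isCoprime_zero_zero hu
  refine ⟨Projectivization.mk ℚ _ h, ?_⟩
  obtain ⟨d, h1, h2⟩ := exists_eq_mul_primCoords (wedge_primCoords_mk h)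
  have hd : IsUnit d := hu.isUnit_of_dvd' ⟨_, h1⟩ ⟨_, h2⟩
  rcases Int.isUnit_iff.mp hd with rfl | rfl
  · left
    exact Prod.ext (by linarith) (by linarith)
  · right
    refine Prod.ext ?_ ?_
    · rw [Prod.fst_neg]; linarith
    · rw [Prod.snd_neg]; linarith

/-- A positive proportion of the integer vectors is primitive, hence the projective line has at
least `Y² / 4` points of height at most `Y`: among the
`Y²` pairs of positive integers up to `Y`, those with a common factor `d ≥ 2` number at most
`(1/4 + ∑_{d ≥ 3} 1 / (d (d - 1))) Y² = 3 Y² / 4`. -/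
theorem le_ncard_ht_le (Y : ℕ) : Y ^ 2 ≤ 4 * {p : P1Q | ht p ≤ Y}.ncard := by
  have h1 := sq_le_card_coprime_add Y
  have h2 := four_mul_sum_sq_div_le Y
  have h3 : ((Finset.Icc 1 Y ×ˢ Finset.Icc 1 Y).filter fun u : ℕ × ℕ => u.1.Coprime u.2).card ≤
      {p : P1Q | ht p ≤ Y}.ncard := by
    rw [← Set.ncard_coe_finset]
    have hex : ∀ u : ℕ × ℕ, ∃ p : P1Q, u.1.Coprime u.2 →
        primCoords p = ((u.1 : ℤ), (u.2 : ℤ)) ∨ primCoords p = -((u.1 : ℤ), (u.2 : ℤ)) := by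
      intro u
      by_cases hu : u.1.Coprime u.2
      · obtain ⟨p, hp⟩ := exists_primCoords_eq (u := ((u.1 : ℤ), (u.2 : ℤ)))
          (Nat.isCoprime_iff_coprime.mpr hu)
        exact ⟨p, fun _ => hp⟩
      · exact ⟨Projectivization.mk ℚ ![1, 0] (by simp), fun h => absurd h hu⟩
    choose φ hφ using hex
    have habs : ∀ u : ℕ × ℕ, u.1.Coprime u.2 →
        (primCoords (φ u)).1.natAbs = u.1 ∧ (primCoords (φ u)).2.natAbs = u.2 := by
      intro u hu
      rcases hφ u hu with h | h <;> simp [h]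
    refine Set.ncard_le_ncard_of_injOn φ ?_ ?_ (finite_ht_le Y)
    · intro u hu
      obtain ⟨hu1, hu2⟩ := Finset.mem_filter.mp hu
      simp only [Finset.mem_product, Finset.mem_Icc] at hu1
      change max _ _ ≤ Y
      rw [(habs u hu2).1, (habs u hu2).2]
      exact max_le hu1.1.2 hu1.2.2
    · intro u hu v hv huv
      have hu2 := (Finset.mem_filter.mp hu).2
      have hv2 := (Finset.mem_filter.mp hv).2
      exact Prod.ext (by rw [← (habs u hu2).1, ← (habs v hv2).1, huv])
        (by rw [← (habs u hu2).2, ← (habs v hv2).2, huv])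
  omega

/-- A label in `ℙ¹(𝔽_p)` for the reduction of `u` modulo `p`; the point at infinity is `none`. -/
def residueClass (p : ℕ) [Fact p.Prime] (u : ℤ × ℤ) : Option (ZMod p) :=
  if (u.2 : ZMod p) = 0 then none else some ((u.1 : ZMod p) / (u.2 : ZMod p))

theorem dvd_wedge_of_residueClass_eq {p : ℕ} [Fact p.Prime] {u v : ℤ × ℤ}
    (h : residueClass p u = residueClass p v) : (p : ℤ) ∣ wedge u v := by
  rw [← ZMod.intCast_zmod_eq_zero_iff_dvd]
  unfold residueClass at h
  unfold wedge
  push_cast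
  split_ifs at h with h1 h2 h2
  · rw [h1, h2]; ring
  · have := Option.some.inj h
    field_simp at this
    rw [this]; ring

/-! ### Points with values in a fixed square class -/

/-- The rational points `u` of height at most `X` such that `f(u)` is `n` times a non-zero square. -/
def conicPoints (f : BinaryForm) (n : ℤ) (X : ℕ) : Set P1Q :=
  {p | ht p ≤ X ∧ ∃ w : ℤ, w ≠ 0 ∧ f.eval (primCoords p) = n * w ^ 2}

theorem conicPoints_finite (f : BinaryForm) (n : ℤ) (X : ℕ) : (conicPoints f n X).Finite :=
  (finite_ht_le X).subset fun _ h => h.1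

theorem abs_le_of_mem_conicPoints {f : BinaryForm} {n : ℤ} {X : ℕ} {p : P1Q}
    (h : p ∈ conicPoints f n X) : |n| ≤ f.size * X ^ 2 := by
  obtain ⟨h1, w, hw, hfw⟩ := h
  obtain ⟨h2, h3⟩ := abs_primCoords_le h1
  have h4 := f.abs_eval_le h2 h3
  rw [hfw, abs_mul] at h4
  have : 1 ≤ |w ^ 2| := Int.one_le_abs (by positivity)
  nlinarith [abs_nonneg n]

/-- The points of `conicPoints f n X` are separated by their classes modulo a prime `p` and the
divisors of `n`, as soon as `p² |n|` exceeds a constant times `X²`. -/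
theorem ncard_conicPoints_le_of_prime {f : BinaryForm} (hf : f.discr ≠ 0) {n : ℤ}
    (hn : Squarefree n) {X p : ℕ} (hp : p.Prime) (hpn : ¬ (p : ℤ) ∣ n)
    (hlarge : |f.discr| * (4 * f.size * X ^ 2) < p ^ 2 * |n|) :
    (conicPoints f n X).ncard ≤ n.natAbs.divisors.card * (p + 1) := by
  have : Fact p.Prime := ⟨hp⟩
  rcases (conicPoints f n X).eq_empty_or_nonempty with h0 | ⟨p₀, hp₀⟩
  · simp [h0]
  have hdvd : ∀ q ∈ conicPoints f n X, n ∣ f.eval (primCoords q) := by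
    rintro q ⟨-, w, -, hw⟩
    exact hw ▸ dvd_mul_right _ _
  let key : P1Q → ℕ × Option (ZMod p) := fun q =>
    (Int.gcd n (wedge (primCoords p₀) (primCoords q)), residueClass p (primCoords q))
  have h : (conicPoints f n X).ncard ≤
      ((n.natAbs.divisors ×ˢ (Finset.univ : Finset (Option (ZMod p))) :
        Finset (ℕ × Option (ZMod p))) : Set (ℕ × Option (ZMod p))).ncard := by
    refine Set.ncard_le_ncard_of_injOn key ?_ ?_ (Finset.finite_toSet _)
    · intro q _
      simp only [key, Finset.coe_product, Set.mem_prod, Finset.mem_coe, Nat.mem_divisors,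
        Finset.mem_univ, and_true]
      exact ⟨Nat.gcd_dvd_left _ _, Int.natAbs_ne_zero.mpr hn.ne_zero⟩
    · intro q hq r hr hqr
      simp only [key, Prod.mk.injEq] at hqr
      obtain ⟨hgcd, hres⟩ := hqr
      have hnW := f.dvd_discr_mul_wedge_of_gcd_eq hn (isCoprime_primCoords p₀) (hdvd _ hp₀)
        (hdvd _ hq) (hdvd _ hr) hgcd
      obtain ⟨hq1, w, -, hw⟩ := hq
      obtain ⟨hr1, w', -, hw'⟩ := hr
      exact eq_of_wedge_eq_zero <| f.wedge_eq_zero_of_dvd hf (isCoprime_primCoords q)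
        (isCoprime_primCoords r) hw hw' (abs_primCoords_le hq1).1 (abs_primCoords_le hq1).2
        (abs_primCoords_le hr1).1 (abs_primCoords_le hr1).2 (Nat.prime_iff_prime_int.mp hp) hpn
        (dvd_wedge_of_residueClass_eq hres) hnW hlarge
  rwa [Set.ncard_coe_finset, Finset.card_product, Finset.card_univ, Fintype.card_option,
    ZMod.card] at h

/-- Uniform bound for the number of points on the conics `f = n w²`. The true order of magnitude
is `X / √|n|`, up to the divisor function. Besides the factor `d(|n|) ≪ X^(1/6)`, a factor `X^(1/6)`
is lost in order to make the auxiliary prime so large that few of its competitors divide `n`. -/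
theorem exists_ncard_conicPoints_le {f : BinaryForm} (hf : f.discr ≠ 0) :
    ∃ C : ℝ, 0 ≤ C ∧ ∀ n : ℤ, Squarefree n → ∀ X : ℕ, 1 ≤ X →
      ((conicPoints f n X).ncard : ℝ) ≤ C * (X : ℝ) ^ (4 / 3 : ℝ) / √|(n : ℝ)| := by
  obtain ⟨C₀, hC₀⟩ := exists_card_divisors_pow_le 12
  obtain ⟨A, hA⟩ : ∃ x : ℝ, x = (f.size : ℝ) := ⟨_, rfl⟩
  have hA1 : 1 ≤ A := by rw [hA]; exact_mod_cast BinaryForm.one_le_size hf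
  obtain ⟨D, hD⟩ : ∃ x : ℝ, x = |(f.discr : ℝ)| := ⟨_, rfl⟩
  have hD0 : 0 ≤ D := hD ▸ abs_nonneg _
  obtain ⟨k, hk⟩ : ∃ x : ℝ, x = 2 * D + A + 1 := ⟨_, rfl⟩
  obtain ⟨a, ha⟩ : ∃ x : ℝ, x = √A := ⟨_, rfl⟩
  have ha1 : 1 ≤ a := ha ▸ Real.one_le_sqrt.mpr hA1
  have haA : a ^ 2 = A := ha ▸ Real.sq_sqrt (by linarith)
  obtain ⟨C₁, hC₁⟩ : ∃ x : ℝ, x = C₀ * A + 1 := ⟨_, rfl⟩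
  have hC₀A : 0 ≤ (C₀ : ℝ) * A := by positivity
  have hk1 : 1 ≤ k := by linarith
  have hC₁1 : 1 ≤ C₁ := by linarith
  refine ⟨C₁ * (2 ^ 14 * (a * k)), by positivity, fun n hn X hX => ?_⟩
  rcases (conicPoints f n X).eq_empty_or_nonempty with h0 | ⟨p₀, hp₀⟩
  · rw [h0, Set.ncard_empty]; push_cast; positivity
  have hnX : |(n : ℝ)| ≤ A * (X : ℝ) ^ 2 := by
    have := abs_le_of_mem_conicPoints hp₀
    rw [hA]
    exact_mod_cast this
  have hn1 : 1 ≤ |(n : ℝ)| := by exact_mod_cast Int.one_le_abs hn.ne_zero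
  have hX1 : (1 : ℝ) ≤ X := by exact_mod_cast hX
  obtain ⟨m, hm⟩ : ∃ x : ℝ, x = √|(n : ℝ)| := ⟨_, rfl⟩
  have hm1 : 1 ≤ m := hm ▸ Real.one_le_sqrt.mpr hn1
  have hmn : m ^ 2 = |(n : ℝ)| := hm ▸ Real.sq_sqrt (by linarith)
  have hmX : m ≤ a * X := by
    apply le_of_sq_le_sq _ (by positivity)
    rw [hmn, mul_pow, haA]; exact hnX
  -- the exponent `1 / 6` makes `t ^ 12 = X ^ 2` dominate `|n|`, and `X * t ^ 2 = X ^ (4 / 3)`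
  obtain ⟨t, ht⟩ : ∃ x : ℝ, x = (X : ℝ) ^ (1 / 6 : ℝ) := ⟨_, rfl⟩
  have ht1 : 1 ≤ t := ht ▸ Real.one_le_rpow hX1 (by norm_num)
  have ht12 : t ^ 12 = (X : ℝ) ^ 2 := by
    rw [ht, ← Real.rpow_natCast, ← Real.rpow_mul (by positivity), ← Real.rpow_natCast]
    norm_num
  have hXt : (X : ℝ) ^ (4 / 3 : ℝ) = X * t ^ 2 := by
    rw [ht, ← Real.rpow_natCast, ← Real.rpow_mul (by positivity)]
    nth_rw 2 [← Real.rpow_one (X : ℝ)]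
    rw [← Real.rpow_add (by linarith)]
    norm_num
  -- `y` is the order of magnitude of the auxiliary prime
  obtain ⟨y, hy⟩ : ∃ x : ℝ, x = a * k * t * (X / m) := ⟨_, rfl⟩
  have hXm : 1 ≤ a * (X / m) := by
    rw [← mul_div_assoc, one_le_div (by positivity)]; exact hmX
  have hyk : k * t ≤ y := by
    rw [hy]; nlinarith [mul_nonneg (show 0 ≤ k by positivity) (show 0 ≤ t by positivity)]
  have hy1 : 1 ≤ y := by nlinarith
  obtain ⟨P, hP⟩ : ∃ x : ℕ, x = ⌈y⌉₊ := ⟨_, rfl⟩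
  have hyP : y ≤ P := hP ▸ Nat.le_ceil y
  have hPy : (P : ℝ) ≤ 2 * y := by
    have := Nat.ceil_lt_add_one (show 0 ≤ y by linarith)
    rw [← hP] at this
    linarith
  have hnP : n.natAbs < P ^ 12 := by
    have : |(n : ℝ)| < (P : ℝ) ^ 12 := by
      calc |(n : ℝ)| ≤ A * (X : ℝ) ^ 2 := hnX
        _ < k * (X : ℝ) ^ 2 := by
          have : A < k := by linarith
          gcongr
        _ ≤ k ^ 12 * t ^ 12 := by
          rw [ht12]
          gcongr
          exact le_self_pow₀ (by linarith) (by norm_num)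
        _ = (k * t) ^ 12 := by ring
        _ ≤ (P : ℝ) ^ 12 := by
          gcongr
          exact hyk.trans hyP
    rw [← Int.cast_abs, Int.abs_eq_natAbs] at this
    exact_mod_cast this
  obtain ⟨p, hp, hPp, hpP, hpn⟩ := exists_prime_not_dvd 12 P n.natAbs
    (by exact_mod_cast hy1.trans hyP) (Int.natAbs_ne_zero.mpr hn.ne_zero) hnP
  have hlarge : |f.discr| * (4 * f.size * (X : ℤ) ^ 2) < (p : ℤ) ^ 2 * |n| := by
    have : D * (4 * A * (X : ℝ) ^ 2) < (p : ℝ) ^ 2 * |(n : ℝ)| := by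
      have hyp : y < p := hyP.trans_lt (by exact_mod_cast hPp)
      have hym : y * m = a * k * t * X := by rw [hy]; field_simp
      calc D * (4 * A * (X : ℝ) ^ 2) ≤ A * k ^ 2 * (X : ℝ) ^ 2 := by
            have : 4 * D ≤ k ^ 2 := by nlinarith
            have h2 : 0 ≤ A * (X : ℝ) ^ 2 := by positivity
            nlinarith
        _ ≤ A * k ^ 2 * (X : ℝ) ^ 2 * t ^ 2 :=
            le_mul_of_one_le_right (by positivity) (one_le_pow₀ ht1)
        _ = (y * m) ^ 2 := by rw [hym, ← haA]; ring
        _ < (p * m) ^ 2 := by gcongr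
        _ = _ := by rw [mul_pow, hmn]
    rw [hA, hD] at this
    exact_mod_cast this
  have hcount := ncard_conicPoints_le_of_prime hf hn hp (by rwa [Int.natCast_dvd]) hlarge
  have hdiv : (n.natAbs.divisors.card : ℝ) ≤ C₁ * t := by
    have h1 : (n.natAbs.divisors.card : ℝ) ^ 12 ≤ C₀ * |(n : ℝ)| := by
      rw [← Int.cast_abs, Int.abs_eq_natAbs]
      exact_mod_cast hC₀ n.natAbs (Int.squarefree_natAbs.mpr hn)
    refine le_of_pow_le_pow_left₀ (n := 12) (by norm_num) (by positivity) (h1.trans ?_)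
    calc (C₀ : ℝ) * |(n : ℝ)| ≤ C₀ * (A * (X : ℝ) ^ 2) := by gcongr
      _ ≤ C₁ * (X : ℝ) ^ 2 := by rw [← mul_assoc]; gcongr; linarith
      _ ≤ C₁ ^ 12 * (X : ℝ) ^ 2 := by
        gcongr
        exact le_self_pow₀ (by linarith) (by norm_num)
      _ = (C₁ * t) ^ 12 := by rw [mul_pow, ht12]
  have hp1 : (p : ℝ) + 1 ≤ 2 ^ 14 * y := by
    have : (p : ℝ) ≤ 2 ^ 12 * P := by exact_mod_cast hpP
    linarith
  calc ((conicPoints f n X).ncard : ℝ) ≤ n.natAbs.divisors.card * (p + 1) := by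
        exact_mod_cast hcount
    _ ≤ (C₁ * t) * (2 ^ 14 * y) := by gcongr
    _ = _ := by rw [hXt, hy, ← hm]; ring

/-! ### Square classes -/

theorem exists_squarefree_mul_sq {a : ℤ} (ha : a ≠ 0) :
    ∃ n w : ℤ, Squarefree n ∧ w ≠ 0 ∧ a = n * w ^ 2 := by
  obtain ⟨m, b, hmb, hm⟩ := Nat.sq_mul_squarefree a.natAbs
  have hb : b ≠ 0 := by
    rintro rfl
    apply ha
    rw [← Int.natAbs_eq_zero, ← hmb]; simp
  have hm' : Squarefree (m : ℤ) := by
    rw [← Int.squarefree_natAbs]; simpa using hm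
  have hab : (a.natAbs : ℤ) = m * b ^ 2 := by rw [← hmb]; push_cast; ring
  rcases Int.natAbs_eq a with h | h
  · exact ⟨m, b, hm', by exact_mod_cast hb, h.trans hab⟩
  · refine ⟨-m, b, ?_, by exact_mod_cast hb, by rw [h, hab]; ring⟩
    rw [← Int.squarefree_natAbs]; simpa using hm

/-- If `a` and `b` have a square product, then they have the same squarefree part. -/
theorem exists_eq_mul_sq_of_isSquare_mul {n w b : ℤ} (hn : Squarefree n) (hw : w ≠ 0)
    (h : IsSquare (n * w ^ 2 * b)) : ∃ r : ℤ, b = n * r ^ 2 := by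
  obtain ⟨s, hs⟩ := h
  have h1 : w ∣ s := by
    rw [← Int.pow_dvd_pow_iff two_ne_zero]
    exact ⟨n * b, by linear_combination -hs⟩
  obtain ⟨t, rfl⟩ := h1
  have h2 : n * b = t ^ 2 := by
    have : w ^ 2 * (n * b) = w ^ 2 * t ^ 2 := by linear_combination hs
    exact mul_left_cancel₀ (pow_ne_zero 2 hw) this
  obtain ⟨r, rfl⟩ := (hn.dvd_pow_iff_dvd two_ne_zero).mp ⟨b, h2.symm⟩
  exact ⟨r, mul_left_cancel₀ hn.ne_zero (by linear_combination h2)⟩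

theorem isSquare_of_isSquare_sq_mul {d n : ℤ} (hd : d ≠ 0) (h : IsSquare (d ^ 2 * n)) :
    IsSquare n := by
  obtain ⟨r, hr⟩ := exists_eq_mul_sq_of_isSquare_mul (n := 1) squarefree_one hd
    (by rwa [one_mul])
  exact ⟨r, by rw [hr]; ring⟩

/-- A form that represents a square does so at the coordinates of a rational point. -/
theorem BinaryForm.Represents.exists_point {f : BinaryForm} {S : ℤ → Prop}
    (hS : S = IsSquare ∨ S = IsNonzeroSquare) (h : f.Represents S) :
    ∃ p : P1Q, S (f.eval (primCoords p)) := by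
  obtain ⟨u, hu, hSu⟩ := h
  have hne : (![(u.1 : ℚ), (u.2 : ℚ)] : Fin 2 → ℚ) ≠ 0 := by
    intro h
    apply hu
    have h1 : u.1 = 0 := by simpa using congrFun h 0
    have h2 : u.2 = 0 := by simpa using congrFun h 1
    exact Prod.ext h1 h2
  refine ⟨Projectivization.mk ℚ _ hne, ?_⟩
  obtain ⟨d, h1, h2⟩ := exists_eq_mul_primCoords (wedge_primCoords_mk hne)
  set v := primCoords (Projectivization.mk ℚ _ hne)
  have hd : d ≠ 0 := by
    rintro rfl
    exact hu (Prod.ext (by simpa using h1) (by simpa using h2))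
  have he : f.eval u = d ^ 2 * f.eval v := by
    simp only [BinaryForm.eval]; rw [h1, h2]; ring
  rw [he] at hSu
  rcases hS with rfl | rfl
  · exact isSquare_of_isSquare_sq_mul hd hSu
  · exact ⟨right_ne_zero_of_mul hSu.1, isSquare_of_isSquare_sq_mul hd hSu.2⟩

/-! ### Counting on the product of two lines -/

theorem anticanonicalHeight_le_iff {x : P1Q × P1Q} {B : ℝ} :
    (anticanonicalHeight x : ℝ) ≤ B ↔ 0 ≤ B ∧ ht x.1 * ht x.2 ≤ ⌊√B⌋₊ := by
  have h : (anticanonicalHeight x : ℝ) = ((ht x.1 * ht x.2 : ℕ) : ℝ) ^ 2 := by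
    unfold anticanonicalHeight
    rw [← natCast_ht, ← natCast_ht]
    push_cast
    ring
  rw [h, Nat.le_floor_iff (Real.sqrt_nonneg _)]
  constructor
  · intro h'
    have hB : 0 ≤ B := (sq_nonneg _).trans h'
    exact ⟨hB, (Real.le_sqrt (Nat.cast_nonneg _) hB).mpr h'⟩
  · rintro ⟨hB, h'⟩
    exact (Real.le_sqrt (Nat.cast_nonneg _) hB).mp h'

theorem countPoints_mono {T T' : Set (P1Q × P1Q)} (h : T ⊆ T') (B : ℝ) :
    countPoints T B ≤ countPoints T' B :=
  Set.ncard_le_ncard (fun _ hx => ⟨h hx.1, hx.2⟩) (finite_height_le T' B)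

theorem countPoints_preimage_swap (T : Set (P1Q × P1Q)) (B : ℝ) :
    countPoints (Prod.swap ⁻¹' T) B = countPoints T B := by
  unfold countPoints
  rw [← Set.ncard_image_of_injective _ Prod.swap_injective, Set.image_swap_eq_preimage_swap]
  congr 1
  ext x
  simp [anticanonicalHeight, mul_comm]

theorem countPoints_union_le (T T' : Set (P1Q × P1Q)) (B : ℝ) :
    countPoints (T ∪ T') B ≤ countPoints T B + countPoints T' B := by
  unfold countPoints
  refine le_trans (le_of_eq ?_) (Set.ncard_union_le _ _)
  congr 1
  ext x
  simp [or_and_right]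

/-- Splitting a count into dyadic ranges for the height of the first coordinate. -/
theorem countPoints_le_sum (T : Set (P1Q × P1Q)) (B : ℝ) :
    countPoints T B ≤ ∑ j ∈ Finset.range (Nat.log 2 ⌊√B⌋₊ + 1),
      {x ∈ T | ht x.1 ≤ 2 ^ (j + 1) ∧ ht x.2 ≤ ⌊√B⌋₊ / 2 ^ j}.ncard := by
  refine le_trans (Set.ncard_le_ncard ?_ ?_) (Finset.set_ncard_biUnion_le _ _)
  · rintro x ⟨hxT, hx⟩
    have h := (anticanonicalHeight_le_iff.mp hx).2
    have h1 := one_le_ht x.1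
    have h2 := one_le_ht x.2
    have h3 : 2 ^ Nat.log 2 (ht x.1) ≤ ht x.1 := Nat.pow_log_le_self 2 (by omega)
    have h4 : ht x.1 < 2 ^ (Nat.log 2 (ht x.1) + 1) := Nat.lt_pow_succ_log_self (by omega) _
    simp only [Set.mem_iUnion, Finset.mem_range]
    refine ⟨Nat.log 2 (ht x.1), ?_, hxT, h4.le, ?_⟩
    · exact Nat.lt_succ_of_le (Nat.log_mono_right ((Nat.le_mul_of_pos_right _ h2).trans h))
    · rw [Nat.le_div_iff_mul_le (by positivity), mul_comm]
      exact (Nat.mul_le_mul_right _ h3).trans h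
  · refine Set.Finite.biUnion (Finset.finite_toSet _) fun j _ => ?_
    exact ((finite_ht_le _).prod (finite_ht_le _)).subset fun x hx => ⟨hx.2.1, hx.2.2⟩

/-- A fibre of the projection to the first line has `≫ B` points. -/
theorem exists_le_countPoints_of_fibre {T : Set (P1Q × P1Q)} {p : P1Q}
    (hT : ∀ q, (p, q) ∈ T) :
    ∃ c B₀ : ℝ, 0 < c ∧ ∀ B : ℝ, B₀ ≤ B → c * B ≤ countPoints T B := by
  have hm : 0 < ht p := one_le_ht p
  have hmR : (0 : ℝ) < ht p := by exact_mod_cast hm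
  refine ⟨1 / (16 * (ht p : ℝ) ^ 2), (ht p : ℝ) ^ 2, by positivity, fun B hB => ?_⟩
  have hB0 : 0 ≤ B := (sq_nonneg _).trans hB
  set R := ⌊√B⌋₊ with hR
  set Y := R / ht p with hY
  have hY1 : 1 ≤ Y := by
    rw [hY, Nat.le_div_iff_mul_le hm, one_mul, hR, Nat.le_floor_iff (Real.sqrt_nonneg _)]
    exact Real.le_sqrt_of_sq_le hB
  have hle : {q : P1Q | ht q ≤ Y}.ncard ≤ countPoints T B := by
    rw [← Set.ncard_image_of_injective _ (Prod.mk_right_injective p)]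
    refine Set.ncard_le_ncard ?_ (finite_height_le T B)
    rintro _ ⟨q, hq, rfl⟩
    refine ⟨hT q, anticanonicalHeight_le_iff.mpr ⟨hB0, ?_⟩⟩
    rw [mul_comm]
    exact (Nat.le_div_iff_mul_le hm).mp hq
  have h4 := (le_ncard_ht_le Y).trans (Nat.mul_le_mul_left 4 hle)
  have h4R : (Y : ℝ) ^ 2 ≤ 4 * countPoints T B := by exact_mod_cast h4
  have hsqrt : √B ≤ 2 * ht p * Y := by
    have h5 : √B < R + 1 := Nat.lt_floor_add_one _
    have h6 : R < ht p * (Y + 1) := by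
      rw [hY]; exact Nat.lt_mul_div_succ R hm
    have h7 : R + 1 ≤ 2 * ht p * Y := by nlinarith
    have h7R : (R : ℝ) + 1 ≤ 2 * ht p * Y := by exact_mod_cast h7
    linarith
  have hBY : B ≤ 4 * (ht p : ℝ) ^ 2 * (Y : ℝ) ^ 2 := by
    calc B = √B ^ 2 := (Real.sq_sqrt hB0).symm
      _ ≤ (2 * ht p * Y) ^ 2 := by gcongr
      _ = _ := by ring
  rw [one_div_mul_eq_div, div_le_iff₀ (by positivity)]
  nlinarith [sq_nonneg (ht p : ℝ)]

/-! ### The first thin set -/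

theorem ncard_zeros_le {f : BinaryForm} (hf : f.discr ≠ 0) (X : ℕ) :
    {p : P1Q | ht p ≤ X ∧ f.eval (primCoords p) = 0}.ncard ≤ 2 := by
  have hfin : {p : P1Q | ht p ≤ X ∧ f.eval (primCoords p) = 0}.Finite :=
    (finite_ht_le X).subset fun _ h => h.1
  by_contra! h
  obtain ⟨p, q, r, hp, hq, hr, hpq, hpr, hqr⟩ := (Set.two_lt_ncard_iff hfin).mp h
  have h0 := f.dvd_discr_mul_wedge (n := 0) (by rw [hp.2]) (by rw [hq.2]) (by rw [hr.2])
  rw [zero_dvd_iff] at h0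
  have h1 : wedge (primCoords p) (primCoords q) ≠ 0 := fun h => hpq (eq_of_wedge_eq_zero h)
  have h2 : wedge (primCoords p) (primCoords r) ≠ 0 := fun h => hpr (eq_of_wedge_eq_zero h)
  have h3 : wedge (primCoords q) (primCoords r) ≠ 0 := fun h => hqr (eq_of_wedge_eq_zero h)
  simp [hf, h1, h2, h3] at h0

theorem exists_ncard_isSquare_le {f : BinaryForm} (hf : f.discr ≠ 0) :
    ∃ C : ℝ, 0 ≤ C ∧ ∀ X : ℕ, 1 ≤ X →
      ({p : P1Q | ht p ≤ X ∧ IsSquare (f.eval (primCoords p))}.ncard : ℝ) ≤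
        C * (X : ℝ) ^ (4 / 3 : ℝ) := by
  obtain ⟨C, hC0, hC⟩ := exists_ncard_conicPoints_le hf
  refine ⟨C + 2, by positivity, fun X hX => ?_⟩
  have h1 := hC 1 squarefree_one X hX
  simp only [Int.cast_one, abs_one, Real.sqrt_one, div_one] at h1
  have hsub : {p : P1Q | ht p ≤ X ∧ IsSquare (f.eval (primCoords p))} ⊆
      conicPoints f 1 X ∪ {p : P1Q | ht p ≤ X ∧ f.eval (primCoords p) = 0} := by
    rintro p ⟨hp, w, hw⟩
    rcases eq_or_ne w 0 with rfl | hw0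
    · exact Or.inr ⟨hp, by simpa using hw⟩
    · exact Or.inl ⟨hp, w, hw0, by rw [hw]; ring⟩
  have h2 := (Set.ncard_le_ncard hsub ((conicPoints_finite f 1 X).union
    ((finite_ht_le X).subset fun _ h => h.1))).trans (Set.ncard_union_le _ _)
  have h3 := h2.trans (Nat.add_le_add_left (ncard_zeros_le hf X) _)
  have h3R : ({p : P1Q | ht p ≤ X ∧ IsSquare (f.eval (primCoords p))}.ncard : ℝ) ≤
      (conicPoints f 1 X).ncard + 2 := by exact_mod_cast h3
  have h4 : 1 ≤ (X : ℝ) ^ (4 / 3 : ℝ) :=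
    Real.one_le_rpow (by exact_mod_cast hX) (by norm_num)
  linarith

/-- The points with `f(u)` a square. The fibre over `u` has `≪ B / H(u)²` points, and the sum of
`H(u)⁻²` over all `u` with `f(u)` a square converges. -/
theorem exists_countPoints_isSquare_le {f : BinaryForm} (hf : f.discr ≠ 0) :
    ∃ C : ℝ, ∀ B : ℝ, 2 ≤ B →
      (countPoints {x | IsSquare (f.eval (primCoords x.1))} B : ℝ) ≤ C * B := by
  obtain ⟨C, hC0, hC⟩ := exists_ncard_isSquare_le hf
  set s : ℝ := 2 ^ (4 / 3 : ℝ) with hs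
  have hs0 : 0 < s := by positivity
  have hs4 : s < 4 := by
    calc s < 2 ^ (2 : ℝ) := Real.rpow_lt_rpow_of_exponent_lt (by norm_num) (by norm_num)
      _ = 4 := by norm_num
  refine ⟨C * s * 9 * (1 - s / 4)⁻¹, fun B hB => ?_⟩
  set R := ⌊√B⌋₊ with hR
  have hRB : (R : ℝ) ^ 2 ≤ B := by
    calc (R : ℝ) ^ 2 ≤ √B ^ 2 := by
          gcongr; exact Nat.floor_le (Real.sqrt_nonneg _)
      _ = B := Real.sq_sqrt (by linarith)
  have hterm : ∀ j : ℕ, ({x ∈ {x : P1Q × P1Q | IsSquare (f.eval (primCoords x.1))} |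
      ht x.1 ≤ 2 ^ (j + 1) ∧ ht x.2 ≤ R / 2 ^ j}.ncard : ℝ) ≤
        C * s * 9 * B * (s / 4) ^ j := by
    intro j
    have hsub : {x ∈ {x : P1Q × P1Q | IsSquare (f.eval (primCoords x.1))} |
        ht x.1 ≤ 2 ^ (j + 1) ∧ ht x.2 ≤ R / 2 ^ j} ⊆
        {p : P1Q | ht p ≤ 2 ^ (j + 1) ∧ IsSquare (f.eval (primCoords p))} ×ˢ
          {q : P1Q | ht q ≤ R / 2 ^ j} := fun x hx => ⟨⟨hx.2.1, hx.1⟩, hx.2.2⟩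
    have h1 := Set.ncard_le_ncard hsub
      (((finite_ht_le _).subset fun _ h => h.1).prod (finite_ht_le _))
    rw [Set.ncard_prod] at h1
    have h2 := hC (2 ^ (j + 1)) Nat.one_le_two_pow
    have hpow : (((2 ^ (j + 1) : ℕ) : ℝ)) ^ (4 / 3 : ℝ) = s ^ (j + 1) := by
      push_cast
      rw [hs, ← Real.rpow_natCast, ← Real.rpow_natCast, ← Real.rpow_mul (by norm_num),
        ← Real.rpow_mul (by norm_num), mul_comm]
    rw [hpow] at h2
    have h3 : ({q : P1Q | ht q ≤ R / 2 ^ j}.ncard : ℝ) ≤ 9 * (B / 4 ^ j) := by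
      have h4 : ({q : P1Q | ht q ≤ R / 2 ^ j}.ncard : ℝ) ≤ 9 * ((R / 2 ^ j : ℕ) : ℝ) ^ 2 := by
        exact_mod_cast ncard_ht_le (R / 2 ^ j)
      have h5 : ((R / 2 ^ j : ℕ) : ℝ) ≤ R / 2 ^ j := by
        have := @Nat.cast_div_le ℝ _ _ _ R (2 ^ j)
        exact_mod_cast this
      calc _ ≤ 9 * ((R / 2 ^ j : ℕ) : ℝ) ^ 2 := h4
        _ ≤ 9 * ((R : ℝ) / 2 ^ j) ^ 2 := by gcongr
        _ = 9 * ((R : ℝ) ^ 2 / 4 ^ j) := by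
          rw [div_pow, ← pow_mul, mul_comm j 2, pow_mul]; norm_num
        _ ≤ _ := by gcongr
    calc _ ≤ (({p : P1Q | ht p ≤ 2 ^ (j + 1) ∧ IsSquare (f.eval (primCoords p))}.ncard : ℕ) : ℝ) *
          ({q : P1Q | ht q ≤ R / 2 ^ j}.ncard : ℝ) := by exact_mod_cast h1
      _ ≤ (C * s ^ (j + 1)) * (9 * (B / 4 ^ j)) := by gcongr
      _ = _ := by rw [div_pow, pow_succ]; ring
  have hsum : ∑ j ∈ Finset.range (Nat.log 2 R + 1), (s / 4) ^ j ≤ (1 - s / 4)⁻¹ := by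
    have h1 : s / 4 < 1 := by linarith
    rw [← tsum_geometric_of_lt_one (by positivity) h1]
    exact (summable_geometric_of_lt_one (by positivity) h1).sum_le_tsum _
      fun _ _ => by positivity
  calc (countPoints {x | IsSquare (f.eval (primCoords x.1))} B : ℝ)
      ≤ ∑ j ∈ Finset.range (Nat.log 2 R + 1),
        ({x ∈ {x : P1Q × P1Q | IsSquare (f.eval (primCoords x.1))} |
          ht x.1 ≤ 2 ^ (j + 1) ∧ ht x.2 ≤ R / 2 ^ j}.ncard : ℝ) := by
        exact_mod_cast countPoints_le_sum _ B
    _ ≤ ∑ j ∈ Finset.range (Nat.log 2 R + 1), C * s * 9 * B * (s / 4) ^ j :=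
        Finset.sum_le_sum fun j _ => hterm j
    _ = C * s * 9 * B * ∑ j ∈ Finset.range (Nat.log 2 R + 1), (s / 4) ^ j := by
        rw [Finset.mul_sum]
    _ ≤ C * s * 9 * B * (1 - s / 4)⁻¹ := by gcongr
    _ = _ := by ring

/-! ### The second thin set -/

/-- The points of the second thin set in a product of boxes. The values of `f` and `g` have the
same squarefree part `n`, and `n` is bounded in terms of the second box. -/
theorem exists_ncard_thinTwo_box_le {f g : BinaryForm} (hf : f.discr ≠ 0) (hg : g.discr ≠ 0) :
    ∃ C : ℝ, 0 ≤ C ∧ ∀ U V : ℕ, 1 ≤ U → 1 ≤ V →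
      ({x ∈ thinTwo IsNonzeroSquare f g | ht x.1 ≤ U ∧ ht x.2 ≤ V}.ncard : ℝ) ≤
        C * ((U * V : ℕ) : ℝ) ^ (4 / 3 : ℝ) * (1 + Real.log (g.size * (V : ℝ) ^ 2)) := by
  obtain ⟨C₁, hC₁0, hC₁⟩ := exists_ncard_conicPoints_le hf
  obtain ⟨C₂, hC₂0, hC₂⟩ := exists_ncard_conicPoints_le hg
  refine ⟨2 * (C₁ * C₂), by positivity, fun U V hU hV => ?_⟩
  set K : ℝ := C₁ * C₂ * ((U * V : ℕ) : ℝ) ^ (4 / 3 : ℝ) with hK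
  have hK0 : 0 ≤ K := by positivity
  set N : ℕ := g.size.toNat * V ^ 2 with hN
  have hNcast : (N : ℝ) = g.size * (V : ℝ) ^ 2 := by
    have : ((g.size.toNat : ℕ) : ℝ) = g.size := by
      exact_mod_cast Int.toNat_of_nonneg g.size_nonneg
    rw [hN]; push_cast; rw [this]
  have hprod : ∀ n : ℤ, Squarefree n →
      ((conicPoints f n U ×ˢ conicPoints g n V).ncard : ℝ) ≤ K * (|(n : ℝ)|)⁻¹ := by
    intro n hn
    rw [Set.ncard_prod]
    push_cast
    calc _ ≤ (C₁ * (U : ℝ) ^ (4 / 3 : ℝ) / √|(n : ℝ)|) *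
          (C₂ * (V : ℝ) ^ (4 / 3 : ℝ) / √|(n : ℝ)|) := by
          gcongr
          · exact hC₁ n hn U hU
          · exact hC₂ n hn V hV
      _ = C₁ * C₂ * ((U : ℝ) ^ (4 / 3 : ℝ) * (V : ℝ) ^ (4 / 3 : ℝ)) *
          (√|(n : ℝ)| * √|(n : ℝ)|)⁻¹ := by
          rw [mul_inv]; ring
      _ = _ := by
          rw [Real.mul_self_sqrt (abs_nonneg _), ← Real.mul_rpow (by positivity) (by positivity),
            hK]
          push_cast
          rfl
  let A : ℤ → Set (P1Q × P1Q) := fun n => conicPoints f n U ×ˢ conicPoints g n V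
  have hAfin : ∀ n, (A n).Finite := fun n =>
    (conicPoints_finite f n U).prod (conicPoints_finite g n V)
  set I := (Finset.Icc 1 N).filter Squarefree with hI
  have hsub : {x ∈ thinTwo IsNonzeroSquare f g | ht x.1 ≤ U ∧ ht x.2 ≤ V} ⊆
      ⋃ m ∈ I, (A (m : ℤ) ∪ A (-(m : ℤ))) := by
    rintro x ⟨⟨hne, hsq⟩, hx1, hx2⟩
    obtain ⟨n, w, hn, hw, hfw⟩ := exists_squarefree_mul_sq (left_ne_zero_of_mul hne)
    rw [hfw] at hsq
    obtain ⟨r, hr⟩ := exists_eq_mul_sq_of_isSquare_mul hn hw hsq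
    have hr0 : r ≠ 0 := by
      rintro rfl
      exact right_ne_zero_of_mul hne (by rw [hr]; ring)
    have hxA : x ∈ A n := ⟨⟨hx1, w, hw, hfw⟩, ⟨hx2, r, hr0, hr⟩⟩
    have hnN : n.natAbs ≤ N := by
      have h1 := abs_le_of_mem_conicPoints hxA.2
      rw [Int.abs_eq_natAbs, ← Int.toNat_of_nonneg g.size_nonneg] at h1
      exact_mod_cast h1
    have hn0 : n.natAbs ≠ 0 := Int.natAbs_ne_zero.mpr hn.ne_zero
    refine Set.mem_biUnion (x := n.natAbs) ?_ ?_
    · exact Finset.mem_filter.mpr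
        ⟨Finset.mem_Icc.mpr ⟨by omega, hnN⟩, Int.squarefree_natAbs.mpr hn⟩
    · rcases Int.natAbs_eq n with h | h
      · exact Or.inl (h ▸ hxA)
      · exact Or.inr (h ▸ hxA)
  have hle := (Set.ncard_le_ncard hsub (Set.Finite.biUnion (Finset.finite_toSet _)
    fun m _ => (hAfin _).union (hAfin _))).trans (Finset.set_ncard_biUnion_le _ _)
  have hterm : ∀ m ∈ I, ((A (m : ℤ) ∪ A (-(m : ℤ))).ncard : ℝ) ≤ 2 * K * (m : ℝ)⁻¹ := by
    intro m hm
    have hm' : Squarefree (m : ℤ) := by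
      rw [← Int.squarefree_natAbs]; simpa using (Finset.mem_filter.mp hm).2
    have hm'' : Squarefree (-(m : ℤ)) := by
      rw [← Int.squarefree_natAbs]; simpa using (Finset.mem_filter.mp hm).2
    have h1 := hprod _ hm'
    have h2 := hprod _ hm''
    have h3 : ((A (m : ℤ) ∪ A (-(m : ℤ))).ncard : ℝ) ≤
        (A (m : ℤ)).ncard + (A (-(m : ℤ))).ncard := by
      exact_mod_cast Set.ncard_union_le _ _
    simp only [Int.cast_neg, Int.cast_natCast, abs_neg, Nat.abs_cast] at h1 h2
    linarith
  have hharm : ∑ m ∈ Finset.Icc 1 N, (m : ℝ)⁻¹ ≤ 1 + Real.log N := by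
    have := harmonic_le_one_add_log N
    rw [harmonic_eq_sum_Icc] at this
    push_cast at this
    exact this
  calc ({x ∈ thinTwo IsNonzeroSquare f g | ht x.1 ≤ U ∧ ht x.2 ≤ V}.ncard : ℝ)
      ≤ ∑ m ∈ I, ((A (m : ℤ) ∪ A (-(m : ℤ))).ncard : ℝ) := by exact_mod_cast hle
    _ ≤ ∑ m ∈ I, 2 * K * (m : ℝ)⁻¹ := Finset.sum_le_sum hterm
    _ ≤ ∑ m ∈ Finset.Icc 1 N, 2 * K * (m : ℝ)⁻¹ :=
        Finset.sum_le_sum_of_subset_of_nonneg (Finset.filter_subset _ _)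
          fun _ _ _ => by positivity
    _ = 2 * K * ∑ m ∈ Finset.Icc 1 N, (m : ℝ)⁻¹ := by rw [Finset.mul_sum]
    _ ≤ 2 * K * (1 + Real.log N) := by gcongr
    _ = _ := by rw [hNcast, hK]; ring

/-- Each of the `≪ log B` dyadic ranges `U × V` for the heights has `U V ≪ √B`, and contributes
`≪ (U V)^(4/3) log B`. -/
theorem exists_countPoints_thinTwo_le {f g : BinaryForm} (hf : f.discr ≠ 0) (hg : g.discr ≠ 0) :
    ∃ C : ℝ, ∀ B : ℝ, 2 ≤ B → (countPoints (thinTwo IsNonzeroSquare f g) B : ℝ) ≤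
      C * B ^ (2 / 3 : ℝ) * Real.log B ^ 9 := by
  obtain ⟨C, hC0, hC⟩ := exists_ncard_thinTwo_box_le hf hg
  set G : ℝ := (g.size : ℝ) with hG
  have hG1 : 1 ≤ G := by rw [hG]; exact_mod_cast BinaryForm.one_le_size hg
  have hlG : 0 ≤ Real.log G := Real.log_nonneg hG1
  set ℓ : ℝ := Real.log 2 with hℓ
  have hℓ0 : 0 < ℓ := Real.log_pos (by norm_num)
  set s : ℝ := 2 ^ (4 / 3 : ℝ) with hs
  have hs0 : 0 < s := by positivity
  set E : ℝ := (1 + Real.log G) / ℓ + 1 with hE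
  have hE0 : 0 < E := by positivity
  refine ⟨2 / ℓ * (C * s * E) / ℓ ^ 7, fun B hB => ?_⟩
  have hBpos : 0 < B := by linarith
  set L : ℝ := Real.log B with hL
  have hℓL : ℓ ≤ L := Real.log_le_log (by norm_num) hB
  have hL0 : 0 < L := by linarith
  set R := ⌊√B⌋₊ with hR
  have hR1 : 1 ≤ R := by
    rw [hR, Nat.one_le_floor_iff]
    exact Real.one_le_sqrt.mpr (by linarith)
  have hR1' : (1 : ℝ) ≤ R := by exact_mod_cast hR1
  have hRB : (R : ℝ) ≤ √B := Nat.floor_le (Real.sqrt_nonneg _)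
  have hRB2 : (R : ℝ) ^ 2 ≤ B := by
    calc (R : ℝ) ^ 2 ≤ √B ^ 2 := by gcongr
      _ = B := Real.sq_sqrt hBpos.le
  have hRpow : (R : ℝ) ^ (4 / 3 : ℝ) ≤ B ^ (2 / 3 : ℝ) := by
    calc (R : ℝ) ^ (4 / 3 : ℝ) ≤ (√B) ^ (4 / 3 : ℝ) := by gcongr
      _ = B ^ (2 / 3 : ℝ) := by
        rw [Real.sqrt_eq_rpow, ← Real.rpow_mul hBpos.le]; norm_num
  have hterm : ∀ j ∈ Finset.range (Nat.log 2 R + 1),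
      ({x ∈ thinTwo IsNonzeroSquare f g | ht x.1 ≤ 2 ^ (j + 1) ∧ ht x.2 ≤ R / 2 ^ j}.ncard : ℝ) ≤
        C * s * E * (B ^ (2 / 3 : ℝ) * L) := by
    intro j hj
    have hjR : 2 ^ j ≤ R := Nat.pow_le_of_le_log (by omega)
      (Nat.lt_succ_iff.mp (Finset.mem_range.mp hj))
    have hV1 : 1 ≤ R / 2 ^ j := by
      rw [Nat.le_div_iff_mul_le (by positivity), one_mul]; exact hjR
    have h := hC (2 ^ (j + 1)) (R / 2 ^ j) Nat.one_le_two_pow hV1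
    have hUV : 2 ^ (j + 1) * (R / 2 ^ j) ≤ 2 * R := by
      calc 2 ^ (j + 1) * (R / 2 ^ j) = 2 * (2 ^ j * (R / 2 ^ j)) := by ring
        _ ≤ 2 * R := Nat.mul_le_mul_left 2 (Nat.mul_div_le R (2 ^ j))
    have hUVR : ((2 ^ (j + 1) * (R / 2 ^ j) : ℕ) : ℝ) ^ (4 / 3 : ℝ) ≤ s * B ^ (2 / 3 : ℝ) := by
      calc ((2 ^ (j + 1) * (R / 2 ^ j) : ℕ) : ℝ) ^ (4 / 3 : ℝ) ≤ (2 * (R : ℝ)) ^ (4 / 3 : ℝ) := by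
            gcongr
            exact_mod_cast hUV
        _ = s * (R : ℝ) ^ (4 / 3 : ℝ) := Real.mul_rpow (by norm_num) (by positivity)
        _ ≤ _ := by gcongr
    have hV1' : (1 : ℝ) ≤ ((R / 2 ^ j : ℕ) : ℝ) := by exact_mod_cast hV1
    have hlog : 1 + Real.log (G * ((R / 2 ^ j : ℕ) : ℝ) ^ 2) ≤ E * L := by
      have h1 : Real.log (G * ((R / 2 ^ j : ℕ) : ℝ) ^ 2) ≤ Real.log (G * B) := by
        apply Real.log_le_log (by positivity)
        have : ((R / 2 ^ j : ℕ) : ℝ) ≤ R := by exact_mod_cast Nat.div_le_self _ _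
        gcongr
        exact (pow_le_pow_left₀ (by positivity) this 2).trans hRB2
      rw [Real.log_mul (y := B) (by positivity) (by positivity)] at h1
      have h2 : 1 + Real.log G ≤ (1 + Real.log G) / ℓ * L := by
        rw [div_mul_eq_mul_div, le_div_iff₀ hℓ0]
        gcongr
      rw [hE, add_mul]
      linarith
    have hlog0 : 0 ≤ 1 + Real.log (G * ((R / 2 ^ j : ℕ) : ℝ) ^ 2) := by
      have : 1 ≤ G * ((R / 2 ^ j : ℕ) : ℝ) ^ 2 := one_le_mul_of_one_le_of_one_le hG1
        (one_le_pow₀ hV1')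
      linarith [Real.log_nonneg this]
    calc _ ≤ _ := h
      _ ≤ C * (s * B ^ (2 / 3 : ℝ)) * (E * L) := by gcongr
      _ = _ := by ring
  have hnum : ((Nat.log 2 R + 1 : ℕ) : ℝ) ≤ 2 / ℓ * L := by
    have h1 : (Nat.log 2 R : ℝ) * ℓ ≤ L := by
      have h2 : ((2 ^ Nat.log 2 R : ℕ) : ℝ) ≤ B := by
        have h3 : ((2 ^ Nat.log 2 R : ℕ) : ℝ) ≤ R := by
          exact_mod_cast Nat.pow_log_le_self 2 (by omega)
        nlinarith
      push_cast at h2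
      rw [hℓ, ← Real.log_pow]
      exact Real.log_le_log (by positivity) h2
    rw [div_mul_eq_mul_div, le_div_iff₀ hℓ0]
    push_cast
    linarith
  calc (countPoints (thinTwo IsNonzeroSquare f g) B : ℝ)
      ≤ ∑ j ∈ Finset.range (Nat.log 2 R + 1),
        ({x ∈ thinTwo IsNonzeroSquare f g |
          ht x.1 ≤ 2 ^ (j + 1) ∧ ht x.2 ≤ R / 2 ^ j}.ncard : ℝ) := by
        exact_mod_cast countPoints_le_sum _ B
    _ ≤ ∑ j ∈ Finset.range (Nat.log 2 R + 1), C * s * E * (B ^ (2 / 3 : ℝ) * L) :=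
        Finset.sum_le_sum hterm
    _ = ((Nat.log 2 R + 1 : ℕ) : ℝ) * (C * s * E * (B ^ (2 / 3 : ℝ) * L)) := by
        rw [Finset.sum_const, Finset.card_range, nsmul_eq_mul]
    _ ≤ (2 / ℓ * L) * (C * s * E * (B ^ (2 / 3 : ℝ) * L)) := by gcongr
    -- only `L ^ 2` is needed; `L ≥ ℓ > 0` allows it to be replaced by `L ^ 9`
    _ = 2 / ℓ * (C * s * E) / ℓ ^ 7 * B ^ (2 / 3 : ℝ) * (ℓ ^ 7 * L ^ 2) := by
        field_simp
    _ ≤ 2 / ℓ * (C * s * E) / ℓ ^ 7 * B ^ (2 / 3 : ℝ) * (L ^ 7 * L ^ 2) := by gcongr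
    _ = _ := by ring

theorem theorem1p2 (f g : BinaryForm) (hf : f.discr ≠ 0) (hg : g.discr ≠ 0) :
    -- the first thin set, whether or not `0` is admitted as a square
    (∀ S : ℤ → Prop, (S = IsSquare ∨ S = IsNonzeroSquare) →
      ((¬ f.Represents S ∧ ¬ g.Represents S) →
        ∀ B : ℝ, countPoints (thinOne S f g) B = 0) ∧
      ((f.Represents S ∨ g.Represents S) →
        (∃ c B₀ : ℝ, 0 < c ∧ ∀ B : ℝ, B₀ ≤ B → c * B ≤ countPoints (thinOne S f g) B) ∧
        (∃ C : ℝ, ∀ B : ℝ, 2 ≤ B → countPoints (thinOne S f g) B ≤ C * B))) ∧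
    -- the second thin set
    (∃ C : ℝ, ∀ B : ℝ, 2 ≤ B →
      countPoints (thinTwo IsNonzeroSquare f g) B ≤ C * B ^ (2 / 3 : ℝ) * Real.log B ^ 9) := by
  refine ⟨fun S hS => ⟨fun ⟨hnf, hng⟩ B => ?_, fun h => ⟨?_, ?_⟩⟩,
    exists_countPoints_thinTwo_le hf hg⟩
  · have hne : ∀ p : P1Q, primCoords p ≠ 0 := by
      intro p h
      have := isCoprime_primCoords p
      rw [h] at this
      exact not_isCoprime_zero_zero this
    have : thinOne S f g = ∅ := by
      refine Set.eq_empty_iff_forall_notMem.mpr fun x hx => ?_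
      rcases hx with hx | hx
      · exact hnf ⟨_, hne _, hx⟩
      · exact hng ⟨_, hne _, hx⟩
    simp [countPoints, this]
  · rcases h with h | h
    · obtain ⟨p, hp⟩ := h.exists_point hS
      exact exists_le_countPoints_of_fibre (p := p) fun q => Or.inl hp
    · obtain ⟨p, hp⟩ := h.exists_point hS
      obtain ⟨c, B₀, hc, hB⟩ := exists_le_countPoints_of_fibre
        (T := Prod.swap ⁻¹' thinOne S f g) (p := p) fun q => Or.inr hp
      exact ⟨c, B₀, hc, fun B h => countPoints_preimage_swap (thinOne S f g) B ▸ hB B h⟩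
  · obtain ⟨C₁, hC₁⟩ := exists_countPoints_isSquare_le hf
    obtain ⟨C₂, hC₂⟩ := exists_countPoints_isSquare_le hg
    refine ⟨C₁ + C₂, fun B hB => ?_⟩
    have hsq : ∀ n : ℤ, S n → IsSquare n := by
      rcases hS with rfl | rfl
      · exact fun _ h => h
      · exact fun _ h => h.2
    have hsub : thinOne S f g ⊆ {x | IsSquare (f.eval (primCoords x.1))} ∪
        Prod.swap ⁻¹' {x | IsSquare (g.eval (primCoords x.1))} := by
      rintro x (hx | hx)
      · exact Or.inl (hsq _ hx)
      · exact Or.inr (hsq _ hx)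
    have h1 := (countPoints_mono hsub B).trans (countPoints_union_le _ _ B)
    rw [countPoints_preimage_swap] at h1
    have h2 : (countPoints (thinOne S f g) B : ℝ) ≤
        countPoints {x | IsSquare (f.eval (primCoords x.1))} B +
          countPoints {x | IsSquare (g.eval (primCoords x.1))} B := by exact_mod_cast h1
    linarith [hC₁ B hB, hC₂ B hB]
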